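/- **Setting.** Let $(Y,d_Y)$ be an infinite compact metric space and $g:Y\to Y$ a continuous surjection satisfying Wieler's axioms: there are $\beta>0$, $K\in\mathbb N^+$, $0<\gamma<1$ such that (1) $d_Y(x,y)\le\beta$ implies $d_Y(g^K(x),g^K(y))\le\gamma^K d_Y(g^{2K}(x),g^{2K}(y))$, and (2) $g^K(B(g^K(x),\epsilon))\subseteq g^{2K}(B(x,\gamma\epsilon))$ for all $x\in Y$, $0<\epsilon\le\beta$. Let $X=\varprojlim(Y,g)=\{\mathbf x=(x_n)_{n\ge0}: g(x_{n+1})=x_n\}$, let $\varphi(\mathbf x)=(g(x_n))_n$, and give $X$ the metric $d_X(\mathbf x,\mathbf y)=\sum_{i=0}^K\gamma^i\sup_n\gamma^n d_Y(\varphi^i(\mathbf x)_n,\varphi^i(\mathbf y)_n)$. Assume that $(X,\varphi)$ is mixing. Put $\epsilon_X=\beta/2$. Let $[\mathbf x,\mathbf y]$ denote the (unique, if it exists) point $\mathbf z\in X$ with $z_m=x_m$ for $m<K$ and $d_Y(z_n,y_n)\le\epsilon_X$ for all $n$; this is the Smale space bracket of $X$. Put $X^s(\mathbf x,\epsilon)=\{\mathbf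 y:[\mathbf x,\mathbf y]=\mathbf y,\ d_X(\mathbf x,\mathbf y)<\epsilon\}$ and $X^u(\mathbf x,\epsilon)=\{\mathbf y:[\mathbf y,\mathbf x]=\mathbf y,\ d_X(\mathbf x,\mathbf y)<\epsilon\}$. Write $\mathbf x\sim_s\mathbf y$ (resp. $\mathbf x\sim_u\mathbf y$) if $d_X(\varphi^n(\mathbf x),\varphi^n(\mathbf y))\to0$ as $n\to+\infty$ (resp. $n\to-\infty$). Let $\mathbf P\subset X$ be finite with $\varphi(\mathbf P)=\mathbf P$, and let $X^u(\mathbf P)=\{\mathbf x:\mathbf x\sim_u\mathbf p\text{ for some }\mathbf p\in\mathbf P\}$ with the topology generated by the sets $X^u(\mathbf x,\epsilon)$, $\mathbf x\in X^u(\mathbf P)$, $0<\epsilon\le\epsilon_X$. The groupoid $G^s(\mathbf P)=\{(\mathbf x,\mathbf y)\in X^u(\mathbf P)^2:\mathbf x\sim_s\mathbf y\}$ has the étale topology generated by the sets $\{(h(\mathbf z),\mathbf z):\mathbf z\in X^u(\mathbf y,\delta)\}$, $h(\mathbf z)=\varphi^{-k}[\varphi^k(\mathbf z),\varphi^k(\mathbf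 x)]$, where $\mathbf x\sim_s\mathbf y$, $\varphi^k(\mathbf x)\in X^s(\varphi^k(\mathbf y),\epsilon_X/2)$, $0<\delta\le\epsilon_X$, $\varphi^k(X^u(\mathbf y,\delta))\subseteq X^u(\varphi^k(\mathbf y),\epsilon_X/2)$, and all brackets involved are defined. Fix $K_0\ge K$ such that $x_i=y_i$ for all $i\le K_0$ implies $d_X(\mathbf x,\mathbf y)<\beta/4$, and $0<\epsilon_Y<\beta/4$ with $\varphi^{K_0}(X^u(\mathbf x,\epsilon_Y))\subseteq X^u(\varphi^{K_0}(\mathbf x),\beta/4)$ for all $\mathbf x\in X$. With $\pi_0(\mathbf x)=x_0$, define the equivalence relation $\sim_0$ on $X^u(\mathbf P)$ by: $\mathbf x\sim_0\mathbf y$ iff $x_0=y_0$ and there are $0<\delta<\epsilon_Y$ and an open $U\subseteq X^u(\mathbf y,\epsilon_Y)$ with $\pi_0(X^u(\mathbf x,\delta))=\pi_0(U)$. Let $X^u(\mathbf P)/{\sim_0}$ have the quotient topology and $G_0(\mathbf P)=\{(\mathbf x,\mathbf y):\mathbf x\sim_0\mathbf y\}\subseteq G^s(\mathbf P)$ the subspace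 topology. For a continuous compactly supported $f:G_0(\mathbf P)\to\mathbb C$ let $\tau_{\mathbf x}(f)=\sum_{\mathbf y\sim_0\mathbf x}f(\mathbf y,\mathbf y)$ (only finitely many terms are non-zero) and let $\tau(f)$ be the function $[\mathbf x]_0\mapsto\tau_{\mathbf x}(f)$ on $X^u(\mathbf P)/{\sim_0}$. **Proposition.** Let $([\mathbf x_n]_0)_{n\in\mathbb N}$ be a convergent sequence in $X^u(\mathbf P)/{\sim_0}$, let $L$ be the set of all its limits, and assume that every subsequence has the same set $L$ of limits. Then $L$ is finite and, for every $f\in C_c(G_0(\mathbf P))$, $$\lim_{n\to\infty}\tau_{\mathbf x_n}(f)=\sum_{[\mathbf w]_0\in L}\tau_{\mathbf w}(f).$$ Consequently, for every $f\in C_c(G_0(\mathbf P))$ the restriction of $\tau(f)$ to the set of Hausdorff points of $X^u(\mathbf P)/{\sim_0}$ is continuous, where a point $c$ is called Hausdorff if every net converging to $c$ has $c$ as its only limit. -/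

import Mathlib

open Filter Topology Set
open scoped CompactlySupported

universe u

noncomputable section

/-- Wieler's axioms: a continuous surjection `g` of the compact metric space `Y`, with constants
`β > 0`, `K ≥ 1` and `0 < γ < 1`. -/
structure WielerSystem (Y : Type u) [MetricSpace Y] [CompactSpace Y] where
  g : Y → Y
  β : ℝ
  K : ℕ
  γ : ℝ
  continuous_g : Continuous g
  surjective_g : Function.Surjective g
  β_pos : 0 < β
  K_pos : 0 < K
  γ_pos : 0 < γ
  γ_lt_one : γ < 1
  axiom_one : ∀ x y : Y, dist x y ≤ β →
    dist (g^[K] x) (g^[K] y) ≤ γ ^ K * dist (g^[2 * K] x) (g^[2 * K] y)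
  axiom_two : ∀ (x : Y) (ε : ℝ), 0 < ε → ε ≤ β →
    g^[K] '' Metric.ball (g^[K] x) ε ⊆ g^[2 * K] '' Metric.ball x (γ * ε)

namespace WielerSystem

variable {Y : Type u} [MetricSpace Y] [CompactSpace Y] (W : WielerSystem Y)

/-! ### The solenoid, its homeomorphism and its metric -/

/-- The inverse limit of `Y ← Y ← Y ← ⋯` with all bonding maps equal to `g`. -/
def X : Type u := {x : ℕ → Y // ∀ i, W.g (x (i + 1)) = x i}

variable {W} in
/-- The coordinate `x_n` of a point of the solenoid. -/
def X.coord (x : W.X) (n : ℕ) : Y := x.1 n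

/-- `φ (x₀, x₁, …) = (g x₀, g x₁, …) = (g x₀, x₀, x₁, …)`, with inverse the shift. -/
def phi : W.X ≃ W.X where
  toFun x := ⟨fun n => W.g (x.1 n), fun i => congrArg W.g (x.2 i)⟩
  invFun x := ⟨fun n => x.1 (n + 1), fun i => x.2 (i + 1)⟩
  left_inv x := Subtype.ext (funext fun n => x.2 n)
  right_inv x := Subtype.ext (funext fun n => x.2 n)

/-- `d'(x, y) = sup_n γ^n d_Y(x_n, y_n)`. -/
def distAux (x y : W.X) : ℝ := ⨆ n, W.γ ^ n * dist (x.coord n) (y.coord n)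

/-- `d_X(x, y) = ∑_{i=0}^{K} γ^i d'(φ^i x, φ^i y)`. -/
def distX (x y : W.X) : ℝ :=
  ∑ i ∈ Finset.range (W.K + 1), W.γ ^ i * W.distAux (W.phi^[i] x) (W.phi^[i] y)

lemma distAux_term_le_diam (x y : W.X) (n : ℕ) :
    W.γ ^ n * dist (x.coord n) (y.coord n) ≤ Metric.diam (univ : Set Y) := by
  have h1 : dist (x.coord n) (y.coord n) ≤ Metric.diam (univ : Set Y) :=
    Metric.dist_le_diam_of_mem isCompact_univ.isBounded (mem_univ _) (mem_univ _)
  have h2 : W.γ ^ n ≤ 1 := pow_le_one₀ W.γ_pos.le W.γ_lt_one.le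
  calc W.γ ^ n * dist (x.coord n) (y.coord n) ≤ 1 * dist (x.coord n) (y.coord n) := by gcongr
    _ ≤ _ := by rw [one_mul]; exact h1

lemma distAux_bdd (x y : W.X) :
    BddAbove (range fun n => W.γ ^ n * dist (x.coord n) (y.coord n)) :=
  ⟨Metric.diam (univ : Set Y), by rintro _ ⟨n, rfl⟩; exact W.distAux_term_le_diam x y n⟩

lemma term_le_distAux (x y : W.X) (n : ℕ) :
    W.γ ^ n * dist (x.coord n) (y.coord n) ≤ W.distAux x y :=
  le_ciSup (W.distAux_bdd x y) n

lemma distAux_nonneg (x y : W.X) : 0 ≤ W.distAux x y :=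
  le_trans (mul_nonneg (pow_nonneg W.γ_pos.le 0) dist_nonneg) (W.term_le_distAux x y 0)

lemma term_le_distX (x y : W.X) {i : ℕ} (hi : i ≤ W.K) :
    W.γ ^ i * W.distAux (W.phi^[i] x) (W.phi^[i] y) ≤ W.distX x y :=
  Finset.single_le_sum
    (f := fun i => W.γ ^ i * W.distAux (W.phi^[i] x) (W.phi^[i] y))
    (fun j _ => mul_nonneg (pow_nonneg W.γ_pos.le j) (W.distAux_nonneg _ _))
    (Finset.mem_range.2 (Nat.lt_succ_of_le hi))

lemma distAux_triangle (x y z : W.X) : W.distAux x z ≤ W.distAux x y + W.distAux y z := by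
  refine ciSup_le fun n => ?_
  have hp : 0 ≤ W.γ ^ n := pow_nonneg W.γ_pos.le n
  calc W.γ ^ n * dist (x.coord n) (z.coord n)
      ≤ W.γ ^ n * (dist (x.coord n) (y.coord n) + dist (y.coord n) (z.coord n)) := by
        gcongr; exact dist_triangle _ _ _
    _ = W.γ ^ n * dist (x.coord n) (y.coord n) + W.γ ^ n * dist (y.coord n) (z.coord n) := by ring
    _ ≤ _ := add_le_add (W.term_le_distAux x y n) (W.term_le_distAux y z n)

/-- The solenoid with the metric `d_X`. -/
instance : MetricSpace W.X where
  dist := W.distX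
  dist_self x := by
    simp [distX, distAux]
  dist_comm x y := by
    simp only [distX, distAux, dist_comm]
  dist_triangle x y z := by
    simp only [distX, ← Finset.sum_add_distrib, ← mul_add]
    refine Finset.sum_le_sum fun i _ => ?_
    exact mul_le_mul_of_nonneg_left (W.distAux_triangle _ _ _) (pow_nonneg W.γ_pos.le i)
  eq_of_dist_eq_zero {x y} h := by
    change W.distX x y = 0 at h
    have h0 : W.distAux x y ≤ 0 := by
      have := W.term_le_distX x y (Nat.zero_le _)
      simpa [h] using this
    refine Subtype.ext (funext fun n => ?_)
    have h1 := (W.term_le_distAux x y n).trans h0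
    have hp : 0 < W.γ ^ n := pow_pos W.γ_pos n
    have h2 : dist (x.coord n) (y.coord n) ≤ 0 := by
      by_contra hc
      exact absurd h1 (not_le.2 (mul_pos hp (not_le.1 hc)))
    exact dist_le_zero.1 h2

lemma dist_eq_distX (x y : W.X) : dist x y = W.distX x y := rfl

/-- The dynamical system `(X, φ)` is mixing. -/
def Mixing : Prop :=
  ∀ U V : Set W.X, IsOpen U → IsOpen V → U.Nonempty → V.Nonempty →
    ∃ N : ℕ, ∀ n ≥ N, (W.phi^[n] '' U ∩ V).Nonempty

/-! ### Stable and unstable equivalence, bracket, local stable and unstable sets -/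

variable {W} in
def StableEquiv (x y : W.X) : Prop :=
  Tendsto (fun n : ℕ => dist (W.phi^[n] x) (W.phi^[n] y)) atTop (𝓝 0)

variable {W} in
def UnstableEquiv (x y : W.X) : Prop :=
  Tendsto (fun n : ℕ => dist (W.phi.symm^[n] x) (W.phi.symm^[n] y)) atTop (𝓝 0)

/-- The Smale space constant `ε_X = β / 2` of the solenoid. -/
def epsX : ℝ := W.β / 2

variable {W} in
/-- `z = [x, y]` for the bracket of the solenoid: `z` has the same first `K` coordinates as `x`,
and shadows `y` in all coordinates. By the first axiom at most one `z` has this property. -/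
def IsBracket (x y z : W.X) : Prop :=
  (∀ m < W.K, z.coord m = x.coord m) ∧ ∀ n, dist (y.coord n) (z.coord n) ≤ W.epsX

/-- `X^s(x, ε) = {y | [x, y] = y and d(x, y) < ε}`. -/
def localStable (x : W.X) (ε : ℝ) : Set W.X := {y | IsBracket x y y ∧ dist x y < ε}

/-- `X^u(x, ε) = {y | [y, x] = y and d(x, y) < ε}`. -/
def localUnstable (x : W.X) (ε : ℝ) : Set W.X := {y | IsBracket y x y ∧ dist x y < ε}

/-- A choice of the constants `K₀` and `ε_Y`. -/
structure Constants where
  K₀ : ℕ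
  εY : ℝ
  K_le : W.K ≤ K₀
  dist_lt : ∀ x y : W.X, (∀ i ≤ K₀, x.coord i = y.coord i) → dist x y < W.β / 4
  εY_pos : 0 < εY
  εY_lt : εY < W.β / 4
  image_subset : ∀ x : W.X,
    W.phi^[K₀] '' W.localUnstable x εY ⊆ W.localUnstable (W.phi^[K₀] x) (W.β / 4)

/-! ### The space `X^u(P)` and the stable groupoid `G^s(P)` -/

/-- `X^u(P)`, the set of points unstably equivalent to a point of `P`. -/
def XuP (P : Set W.X) : Type u := {x : W.X // ∃ p ∈ P, UnstableEquiv x p}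

variable {W} {P : Set W.X}

/-- The local unstable set `X^u(x, ε)` as a subset of `X^u(P)`. -/
def locU (x : W.XuP P) (ε : ℝ) : Set (W.XuP P) := {y | y.1 ∈ W.localUnstable x.1 ε}

/-- The topology of `X^u(P)`, generated by the local unstable sets (and not the one inherited
from `X`). -/
instance : TopologicalSpace (W.XuP P) :=
  TopologicalSpace.generateFrom
    {U | ∃ (x : W.XuP P) (ε : ℝ), 0 < ε ∧ ε ≤ W.epsX ∧ U = locU x ε}

def pi0 (x : W.XuP P) : Y := x.1.coord 0

variable (W P) in
/-- The stable groupoid `G^s(P)`. -/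
def Gs : Type u := {p : W.XuP P × W.XuP P // StableEquiv p.1.1 p.2.1}

/-- Data `(x, y, k, δ)` defining the local homeomorphism
`h : X^u(y, δ) → X^u(P)`, `h z = φ^{-k} [φ^k z, φ^k x]`; the last clause says that all the
brackets involved are defined. -/
def IsChart (x y : W.XuP P) (k : ℕ) (δ : ℝ) : Prop :=
  0 < δ ∧ δ ≤ W.epsX ∧
  W.phi^[k] x.1 ∈ W.localStable (W.phi^[k] y.1) (W.epsX / 2) ∧
  W.phi^[k] '' W.localUnstable y.1 δ ⊆ W.localUnstable (W.phi^[k] y.1) (W.epsX / 2) ∧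
  ∀ z ∈ W.localUnstable y.1 δ, ∃ w, IsBracket (W.phi^[k] z) (W.phi^[k] x.1) w

/-- The set `{(h z, z) | z ∈ X^u(y, δ)}` where `h z = φ^{-k} [φ^k z, φ^k x]`. -/
def chartSet (x y : W.XuP P) (k : ℕ) (δ : ℝ) : Set (W.Gs P) :=
  {q | q.1.2 ∈ locU y δ ∧
    IsBracket (W.phi^[k] q.1.2.1) (W.phi^[k] x.1) (W.phi^[k] q.1.1.1)}

/-- The étale topology of `G^s(P)`. -/
instance : TopologicalSpace (W.Gs P) :=
  TopologicalSpace.generateFrom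
    {V | ∃ (x y : W.XuP P) (k : ℕ) (δ : ℝ),
      StableEquiv x.1 y.1 ∧ IsChart x y k δ ∧ V = chartSet x y k δ}

/-! ### The relation `∼₀` -/

/-- The relation `x ∼₀ y` on `X^u(P)`. -/
def Rel0 (C : W.Constants) (x y : W.XuP P) : Prop :=
  pi0 x = pi0 y ∧
  ∃ δ : ℝ, 0 < δ ∧ δ < C.εY ∧
    ∃ U : Set (W.XuP P), IsOpen U ∧ U ⊆ locU y C.εY ∧ pi0 '' locU x δ = pi0 '' U

/-! ### `∼₀` is an equivalence relation -/

lemma coord_phi_iterate (x : W.X) (i n : ℕ) :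
    X.coord (W.phi^[i] x) n = W.g^[i] (x.coord n) := by
  induction i with
  | zero => rfl
  | succ i ih =>
    rw [Function.iterate_succ_apply', Function.iterate_succ_apply', ← ih]; rfl

lemma iterate_coord (x : W.X) (i n : ℕ) : W.g^[i] (x.coord (n + i)) = x.coord n := by
  induction i with
  | zero => rfl
  | succ i ih =>
    rw [Function.iterate_succ_apply, ← ih]
    exact congrArg _ (x.2 (n + i))

lemma coord_le_distX (x y : W.X) {i : ℕ} (hi : i ≤ W.K) :
    W.γ ^ i * dist (W.g^[i] (x.coord 0)) (W.g^[i] (y.coord 0)) ≤ dist x y := by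
  refine le_trans ?_ (W.term_le_distX x y hi)
  refine mul_le_mul_of_nonneg_left ?_ (pow_nonneg W.γ_pos.le i)
  have := W.term_le_distAux (W.phi^[i] x) (W.phi^[i] y) 0
  simpa [coord_phi_iterate] using this

lemma contract (x y : W.X) (h : ∀ n, dist (x.coord n) (y.coord n) ≤ W.β) (n : ℕ) :
    dist (x.coord (n + W.K)) (y.coord (n + W.K)) ≤
      W.γ ^ W.K * dist (x.coord n) (y.coord n) := by
  have := W.axiom_one _ _ (h (n + 2 * W.K))
  rw [iterate_coord, iterate_coord, show n + 2 * W.K = (n + W.K) + W.K by ring,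
    iterate_coord, iterate_coord] at this
  exact this

lemma coord_le (x y : W.X) (h : ∀ n, dist (x.coord n) (y.coord n) ≤ W.β) (n : ℕ) :
    dist (x.coord n) (y.coord n) ≤ W.γ ^ n * dist x y := by
  induction n using Nat.strong_induction_on with
  | _ n ih =>
    rcases le_total n W.K with hn | hn
    · have h1 := W.axiom_one _ _ (h (n + W.K))
      have e : ∀ z : W.X, W.g^[2 * W.K] (z.coord (n + W.K)) = W.g^[W.K - n] (z.coord 0) := by
        intro z
        rw [show 2 * W.K = (W.K - n) + (n + W.K) by omega, Function.iterate_add_apply]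
        congr 1
        have := iterate_coord z (n + W.K) 0
        rwa [zero_add] at this
      rw [iterate_coord, iterate_coord, e, e] at h1
      have h2 := coord_le_distX x y (Nat.sub_le W.K n)
      calc _ ≤ _ := h1
        _ = W.γ ^ n * (W.γ ^ (W.K - n) *
              dist (W.g^[W.K - n] (x.coord 0)) (W.g^[W.K - n] (y.coord 0))) := by
            rw [← mul_assoc, ← pow_add, Nat.add_sub_cancel' hn]
        _ ≤ _ := mul_le_mul_of_nonneg_left h2 (pow_nonneg W.γ_pos.le n)
    · obtain ⟨m, rfl⟩ := Nat.exists_eq_add_of_le' hn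
      calc _ ≤ _ := contract x y h m
        _ ≤ W.γ ^ W.K * (W.γ ^ m * dist x y) :=
            mul_le_mul_of_nonneg_left (ih m (by have := W.K_pos; omega))
              (pow_nonneg W.γ_pos.le _)
        _ = _ := by rw [← mul_assoc, ← pow_add, add_comm]

lemma coord_le_dist (x y : W.X) (h : ∀ n, dist (x.coord n) (y.coord n) ≤ W.β) (n : ℕ) :
    dist (x.coord n) (y.coord n) ≤ dist x y :=
  (coord_le x y h n).trans
    (mul_le_of_le_one_left dist_nonneg (pow_le_one₀ W.γ_pos.le W.γ_lt_one.le))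

lemma dist_lt_of_coord_zero {ρ : ℝ} (hρ : 0 < ρ) : ∃ η > 0, ∀ x y : W.X,
    (∀ n, dist (x.coord n) (y.coord n) ≤ W.β) → dist (x.coord 0) (y.coord 0) < η →
      dist x y < ρ := by
  set r : ℝ := ρ / (2 * (W.K + 1)) with hr
  have hK : (0 : ℝ) < W.K + 1 := by positivity
  have hr0 : 0 < r := by positivity
  have huc : ∀ i : ℕ, ∃ η > 0, ∀ a b : Y, dist a b < η → dist (W.g^[i] a) (W.g^[i] b) < r :=
    fun i => by
      have := CompactSpace.uniformContinuous_of_continuous (W.continuous_g.iterate i)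
      obtain ⟨η, h1, h2⟩ := Metric.uniformContinuous_iff.1 this r hr0
      exact ⟨η, h1, fun a b hab => h2 hab⟩
  choose e he0 he using huc
  obtain ⟨η, hη0, hη⟩ : ∃ η > 0, ∀ i ∈ Finset.range (W.K + 1), η ≤ e i := by
    refine ⟨(Finset.range (W.K + 1)).inf' ⟨0, by simp⟩ e, ?_, fun i hi => Finset.inf'_le _ hi⟩
    exact (Finset.lt_inf'_iff _).2 fun i _ => he0 i
  refine ⟨η, hη0, fun x y hxy h0 => ?_⟩
  have hmul : ∀ j, dist (x.coord (j * W.K)) (y.coord (j * W.K)) < η := by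
    intro j
    induction j with
    | zero => simpa using h0
    | succ j ih =>
      rw [Nat.succ_mul]
      refine lt_of_le_of_lt ((contract x y hxy _).trans ?_) ih
      exact mul_le_of_le_one_left dist_nonneg (pow_le_one₀ W.γ_pos.le W.γ_lt_one.le)
  have hneg : ∀ i ≤ W.K, dist (W.g^[i] (x.coord 0)) (W.g^[i] (y.coord 0)) < r := fun i hi =>
    he i _ _ (h0.trans_le (hη i (Finset.mem_range.2 (Nat.lt_succ_of_le hi))))
  have hpos : ∀ m, dist (x.coord m) (y.coord m) < r := by
    intro m
    have hKp := W.K_pos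
    have hlt := Nat.mod_lt m hKp
    have hdm := Nat.div_add_mod m W.K
    have hcomm := Nat.mul_comm W.K (m / W.K)
    have hsucc : (m / W.K + 1) * W.K = m + (W.K - m % W.K) := by
      rw [Nat.succ_mul]; omega
    have h1 := hmul (m / W.K + 1)
    rw [hsucc] at h1
    have h2 := he (W.K - m % W.K) _ _
      (h1.trans_le (hη _ (Finset.mem_range.2 (by omega))))
    rwa [iterate_coord, iterate_coord] at h2
  have hall : ∀ i ≤ W.K, ∀ n,
      dist (W.g^[i] (x.coord n)) (W.g^[i] (y.coord n)) < r := by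
    intro i hi n
    rcases le_total i n with hin | hin
    · obtain ⟨m, rfl⟩ := Nat.exists_eq_add_of_le' hin
      rw [iterate_coord, iterate_coord]
      exact hpos m
    · have e2 : ∀ z : W.X, W.g^[i] (z.coord n) = W.g^[i - n] (z.coord 0) := by
        intro z
        conv_lhs => rw [← Nat.sub_add_cancel hin, Function.iterate_add_apply]
        congr 1
        have := iterate_coord z n 0
        rwa [zero_add] at this
      rw [e2, e2]
      exact hneg _ ((Nat.sub_le _ _).trans hi)
  have haux : ∀ i ∈ Finset.range (W.K + 1),
      W.γ ^ i * W.distAux (W.phi^[i] x) (W.phi^[i] y) ≤ r := by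
    intro i hi
    have hi' : i ≤ W.K := Nat.lt_succ_iff.1 (Finset.mem_range.1 hi)
    have h1 : W.distAux (W.phi^[i] x) (W.phi^[i] y) ≤ r := by
      refine ciSup_le fun n => ?_
      rw [coord_phi_iterate, coord_phi_iterate]
      exact (mul_le_of_le_one_left dist_nonneg
        (pow_le_one₀ W.γ_pos.le W.γ_lt_one.le)).trans (hall i hi' n).le
    exact (mul_le_of_le_one_left (W.distAux_nonneg _ _)
      (pow_le_one₀ W.γ_pos.le W.γ_lt_one.le)).trans h1
  have hsum := Finset.sum_le_card_nsmul _ _ _ haux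
  rw [Finset.card_range, nsmul_eq_mul] at hsum
  have : W.distX x y ≤ ρ / 2 := by
    refine hsum.trans_eq ?_
    rw [hr]; push_cast; field_simp
  exact lt_of_le_of_lt this (by linarith)

lemma mem_locU {x y : W.XuP P} {ε : ℝ} : y ∈ locU x ε ↔
    (∀ n, dist (x.1.coord n) (y.1.coord n) ≤ W.epsX) ∧ dist x.1 y.1 < ε :=
  ⟨fun h => ⟨h.1.2, h.2⟩, fun h => ⟨⟨fun _ _ => rfl, h.1⟩, h.2⟩⟩

lemma epsX_pos : 0 < W.epsX := half_pos W.β_pos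

lemma self_mem_locU (x : W.XuP P) {ε : ℝ} (hε : 0 < ε) : x ∈ locU x ε :=
  mem_locU.2 ⟨fun n => by rw [dist_self]; exact epsX_pos.le, by rwa [dist_self]⟩

lemma isOpen_locU (x : W.XuP P) {ε : ℝ} (h0 : 0 < ε) (h1 : ε ≤ W.epsX) :
    IsOpen (locU x ε) :=
  TopologicalSpace.isOpen_generateFrom_of_mem ⟨x, ε, h0, h1, rfl⟩

lemma locU_mono (x : W.XuP P) {ε ε' : ℝ} (h : ε ≤ ε') : locU x ε ⊆ locU x ε' :=
  fun _ hy => mem_locU.2 ⟨(mem_locU.1 hy).1, (mem_locU.1 hy).2.trans_le h⟩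

lemma epsX_le : W.epsX ≤ W.β := half_le_self W.β_pos.le

lemma exists_locU_subset {U : Set (W.XuP P)} (hU : IsOpen U) {w : W.XuP P} (hw : w ∈ U) :
    ∃ η, 0 < η ∧ locU w η ⊆ U := by
  induction hU with
  | basic s hs =>
    obtain ⟨x, ε, h0, h1, rfl⟩ := hs
    have hxw := mem_locU.1 hw
    refine ⟨ε - dist x.1 w.1, sub_pos.2 hxw.2, fun v hv => ?_⟩
    have hwv := mem_locU.1 hv
    have a := coord_le_dist _ _ (fun n => (hxw.1 n).trans epsX_le)
    have b := coord_le_dist _ _ (fun n => (hwv.1 n).trans epsX_le)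
    refine mem_locU.2 ⟨fun n => ?_, ?_⟩
    · have := dist_triangle (x.1.coord n) (w.1.coord n) (v.1.coord n)
      linarith [a n, b n, hwv.2]
    · have := dist_triangle x.1 w.1 v.1
      linarith [hwv.2]
  | univ => exact ⟨1, one_pos, subset_univ _⟩
  | inter s t _ _ hs ht =>
    obtain ⟨a, ha, hsa⟩ := hs hw.1
    obtain ⟨b, hb, htb⟩ := ht hw.2
    exact ⟨min a b, lt_min ha hb, subset_inter
      ((locU_mono w (min_le_left _ _)).trans hsa) ((locU_mono w (min_le_right _ _)).trans htb)⟩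
  | sUnion S _ hS =>
    obtain ⟨s, hsS, hws⟩ := hw
    obtain ⟨η, hη, h⟩ := hS s hsS hws
    exact ⟨η, hη, h.trans (subset_sUnion_of_mem hsS)⟩

lemma exists_dist_pi0 {x w : W.XuP P} {ε : ℝ} (hw : w ∈ locU x ε) {η : ℝ} (hη : 0 < η) :
    ∃ ρ > 0, ∀ v ∈ locU x ε, dist (pi0 v) (pi0 w) < ρ → v ∈ locU w η := by
  obtain ⟨ρ, hρ, h⟩ := W.dist_lt_of_coord_zero (ρ := min η W.epsX) (lt_min hη epsX_pos)
  refine ⟨ρ, hρ, fun v hv hvw => ?_⟩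
  have hβ : ∀ n, dist (w.1.coord n) (v.1.coord n) ≤ W.β := by
    intro n
    have h1 := (mem_locU.1 hw).1 n
    have h2 := (mem_locU.1 hv).1 n
    have h3 := dist_triangle_left (w.1.coord n) (v.1.coord n) (x.1.coord n)
    have h4 : W.epsX = W.β / 2 := rfl
    linarith
  have h1 := h w.1 v.1 hβ (by rw [dist_comm]; exact hvw)
  exact mem_locU.2 ⟨fun n => (coord_le_dist _ _ hβ n).trans (h1.le.trans (min_le_right _ _)),
    h1.trans_le (min_le_left _ _)⟩

lemma continuous_pi0 : Continuous (pi0 : W.XuP P → Y) := by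
  rw [continuous_iff_continuousAt]
  intro w
  rw [ContinuousAt, Metric.tendsto_nhds]
  intro ε hε
  have h0 : 0 < min ε W.epsX := lt_min hε epsX_pos
  filter_upwards [(isOpen_locU w h0 (min_le_right _ _)).mem_nhds (self_mem_locU w h0)] with v hv
  have hv := mem_locU.1 hv
  have := coord_le_dist _ _ (fun n => (hv.1 n).trans epsX_le) 0
  rw [dist_comm]
  exact lt_of_le_of_lt this (hv.2.trans_le (min_le_left _ _))

lemma map_pi0_nhds {x w : W.XuP P} {ε : ℝ} {A : Set (W.XuP P)} (hA : IsOpen A)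
    (hAx : A ⊆ locU x ε) (hw : w ∈ A) : map pi0 (𝓝 w) = 𝓝[pi0 '' A] (pi0 w) := by
  apply le_antisymm
  · refine tendsto_nhdsWithin_iff.2 ⟨continuous_pi0.tendsto w, ?_⟩
    filter_upwards [hA.mem_nhds hw] with v hv using mem_image_of_mem _ hv
  · intro S hS
    obtain ⟨U, hUS, hU, hwU⟩ := mem_nhds_iff.1 (mem_map.1 hS)
    obtain ⟨η, hη, hηU⟩ := exists_locU_subset hU hwU
    obtain ⟨ρ, hρ, h⟩ := exists_dist_pi0 (hAx hw) hη
    refine mem_nhdsWithin.2 ⟨Metric.ball (pi0 w) ρ, Metric.isOpen_ball,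
      Metric.mem_ball_self hρ, ?_⟩
    rintro _ ⟨hv, v, hvA, rfl⟩
    exact hUS (hηU (h v (hAx hvA) hv))

lemma pi0_injOn (x : W.XuP P) (ε : ℝ) : InjOn pi0 (locU x ε) := by
  intro v hv w hw hvw
  refine Subtype.ext (dist_le_zero.1 (le_of_forall_pos_le_add fun η hη => ?_))
  obtain ⟨ρ, hρ, h⟩ := exists_dist_pi0 hw hη
  have := mem_locU.1 (h v hv (by rw [hvw, dist_self]; exact hρ))
  rw [zero_add, dist_comm]
  exact this.2.le

variable {C : W.Constants}

lemma εY_le : C.εY ≤ W.epsX := by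
  have h1 := C.εY_lt
  have h2 : W.epsX = W.β / 2 := rfl
  linarith [W.β_pos]

lemma rel0_iff {x y : W.XuP P} : Rel0 C x y ↔ map pi0 (𝓝 x) = map pi0 (𝓝 y) := by
  constructor
  · rintro ⟨h0, δ, hδ, hδC, U, hU, hUy, hπ⟩
    have hxδ := self_mem_locU x hδ
    obtain ⟨v, hvU, hv⟩ : pi0 x ∈ pi0 '' U := hπ ▸ mem_image_of_mem _ hxδ
    have hyU : y ∈ U := by
      rwa [← pi0_injOn y C.εY (hUy hvU) (self_mem_locU y C.εY_pos) (hv.trans h0)]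
    rw [map_pi0_nhds (isOpen_locU x hδ (hδC.le.trans εY_le)) Subset.rfl hxδ,
      map_pi0_nhds hU hUy hyU, hπ, h0]
  · intro h
    have hx := self_mem_locU x C.εY_pos
    have hy := self_mem_locU y C.εY_pos
    have hox := isOpen_locU x C.εY_pos εY_le
    have hoy := isOpen_locU y C.εY_pos εY_le
    have h0 : pi0 x = pi0 y := by
      have h1 : Tendsto pi0 (𝓝 x) (𝓝 (pi0 x)) := continuous_pi0.tendsto x
      have h2 : Tendsto pi0 (𝓝 x) (𝓝 (pi0 y)) := by
        rw [Tendsto, h]; exact continuous_pi0.tendsto y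
      exact tendsto_nhds_unique h1 h2
    rw [map_pi0_nhds hox Subset.rfl hx, map_pi0_nhds hoy Subset.rfl hy, ← h0,
      nhdsWithin_eq_iff_eventuallyEq] at h
    obtain ⟨O, hO, hOopen, hxO⟩ := mem_nhds_iff.1 h.mem_iff
    obtain ⟨δ₀, hδ₀, hsub⟩ := exists_locU_subset (hOopen.preimage continuous_pi0)
      (show x ∈ pi0 ⁻¹' O from hxO)
    have hδ : 0 < min δ₀ (C.εY / 2) := lt_min hδ₀ (half_pos C.εY_pos)
    have hδC : min δ₀ (C.εY / 2) < C.εY := (min_le_right _ _).trans_lt (half_lt_self C.εY_pos)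
    refine ⟨h0, _, hδ, hδC, locU y C.εY ∩ pi0 ⁻¹' (pi0 '' locU x (min δ₀ (C.εY / 2))), ?_,
      inter_subset_left, ?_⟩
    · rw [isOpen_iff_mem_nhds]
      rintro v ⟨hvy, w, hw, hwv⟩
      have hwx := locU_mono x hδC.le hw
      have hwO : pi0 w ∈ O := hsub (locU_mono x (min_le_left _ _) hw)
      have e : map pi0 (𝓝 v) = map pi0 (𝓝 w) := by
        rw [map_pi0_nhds hoy Subset.rfl hvy, map_pi0_nhds hox Subset.rfl hwx, ← hwv,
          nhdsWithin_eq_iff_eventuallyEq]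
        filter_upwards [hOopen.mem_nhds hwO] with z hz using propext (hO hz).symm
      refine inter_mem (hoy.mem_nhds hvy) ?_
      have : pi0 '' locU x (min δ₀ (C.εY / 2)) ∈ map pi0 (𝓝 w) :=
        image_mem_map ((isOpen_locU x hδ (hδC.le.trans εY_le)).mem_nhds hw)
      rw [← e] at this
      exact this
    · ext z
      constructor
      · rintro ⟨w, hw, rfl⟩
        have hwO : pi0 w ∈ O := hsub (locU_mono x (min_le_left _ _) hw)
        have : pi0 w ∈ pi0 '' locU y C.εY :=
          (hO hwO).mp (mem_image_of_mem _ (locU_mono x hδC.le hw))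
        obtain ⟨v, hv, hvw⟩ := this
        exact ⟨v, ⟨hv, w, hw, hvw.symm⟩, hvw⟩
      · rintro ⟨v, ⟨_, hv⟩, rfl⟩
        exact hv

variable (P C) in
/-- `∼₀` as an equivalence relation. -/
def setoid0 : Setoid (W.XuP P) where
  r := Rel0 C
  iseqv :=
    { refl := fun _ => rel0_iff.2 rfl
      symm := fun h => rel0_iff.2 (rel0_iff.1 h).symm
      trans := fun h h' => rel0_iff.2 ((rel0_iff.1 h).trans (rel0_iff.1 h')) }

lemma Rel0.stableEquiv {x y : W.XuP P} (h : Rel0 C x y) : StableEquiv x.1 y.1 := by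
  have h0 : x.1.coord 0 = y.1.coord 0 := h.1
  have h1 : ∀ m : ℕ, W.distAux (W.phi^[m] x.1) (W.phi^[m] y.1) ≤
      W.γ ^ m * Metric.diam (univ : Set Y) := by
    intro m
    refine ciSup_le fun n => ?_
    rw [coord_phi_iterate, coord_phi_iterate]
    rcases le_total n m with hnm | hnm
    · have e : ∀ z : W.X, W.g^[m] (z.coord n) = W.g^[m - n] (z.coord 0) := by
        intro z
        conv_lhs => rw [← Nat.sub_add_cancel hnm, Function.iterate_add_apply]
        congr 1
        have := iterate_coord z n 0
        rwa [zero_add] at this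
      rw [e, e, h0, dist_self, mul_zero]
      exact mul_nonneg (pow_nonneg W.γ_pos.le _) Metric.diam_nonneg
    · exact mul_le_mul (pow_le_pow_of_le_one W.γ_pos.le W.γ_lt_one.le hnm)
        (Metric.dist_le_diam_of_mem isCompact_univ.isBounded (mem_univ _) (mem_univ _))
        dist_nonneg (pow_nonneg W.γ_pos.le _)
  have h2 : ∀ n : ℕ, dist (W.phi^[n] x.1) (W.phi^[n] y.1) ≤
      (W.K + 1 : ℕ) * (W.γ ^ n * Metric.diam (univ : Set Y)) := by
    intro n
    rw [dist_eq_distX, distX, ← nsmul_eq_mul]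
    refine (Finset.sum_le_card_nsmul (Finset.range (W.K + 1)) _ _ fun i _ => ?_).trans_eq
      (by rw [Finset.card_range])
    rw [← Function.iterate_add_apply, ← Function.iterate_add_apply]
    refine (mul_le_of_le_one_left (W.distAux_nonneg _ _)
      (pow_le_one₀ W.γ_pos.le W.γ_lt_one.le)).trans ((h1 _).trans ?_)
    exact mul_le_mul_of_nonneg_right
      (pow_le_pow_of_le_one W.γ_pos.le W.γ_lt_one.le (Nat.le_add_left n i)) Metric.diam_nonneg
  refine squeeze_zero (fun _ => dist_nonneg) h2 ?_
  have := ((tendsto_pow_atTop_nhds_zero_of_lt_one W.γ_pos.le W.γ_lt_one).mul_const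
    (Metric.diam (univ : Set Y))).const_mul ((W.K + 1 : ℕ) : ℝ)
  simpa using this

/-! ### The quotient space, the groupoid `G₀(P)` and the traces -/

variable (P C) in
/-- The quotient `X^u(P) / ∼₀`, with the quotient topology. -/
abbrev Q0 : Type u := Quotient (setoid0 P C)

variable (P) in
/-- The class `[x]₀`. -/
def cls (C : W.Constants) (x : W.XuP P) : Q0 P C := Quotient.mk (setoid0 P C) x

variable (P C) in
/-- The groupoid `G₀(P) = {(x, y) | x ∼₀ y}`. -/
def G0 : Type u := {p : W.XuP P × W.XuP P // Rel0 C p.1 p.2}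

/-- The inclusion of `G₀(P)` in `G^s(P)`. -/
def G0.toGs (p : G0 P C) : W.Gs P := ⟨p.1, p.2.stableEquiv⟩

/-- `G₀(P)` has the topology inherited from `G^s(P)`. -/
instance : TopologicalSpace (G0 P C) := TopologicalSpace.induced G0.toGs inferInstance

/-- The unit `(y, y)` of `G₀(P)`. -/
def diag (C : W.Constants) (y : W.XuP P) : G0 P C := ⟨(y, y), (setoid0 P C).refl y⟩

/-- `τ_x(f) = ∑_{y ∼₀ x} f(y, y)`. -/
def traceAt (f : C_c(G0 P C, ℂ)) (x : W.XuP P) : ℂ :=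
  ∑ᶠ (y : W.XuP P) (_ : Rel0 C y x), f (diag C y)

lemma traceAt_congr (f : C_c(G0 P C, ℂ)) {x x' : W.XuP P} (h : Rel0 C x x') :
    traceAt f x = traceAt f x' := by
  have : ∀ y, Rel0 C y x ↔ Rel0 C y x' := fun y =>
    ⟨fun h' => (setoid0 P C).trans h' h, fun h' => (setoid0 P C).trans h' ((setoid0 P C).symm h)⟩
  simp only [traceAt, this]

/-- `τ(f)`, the function `[x]₀ ↦ τ_x(f)` on the quotient space. -/
def trace (f : C_c(G0 P C, ℂ)) : Q0 P C → ℂ :=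
  Quotient.lift (traceAt f) fun _ _ h => traceAt_congr f h

/-- The set of all limits of a sequence in the (possibly non-Hausdorff) quotient space. -/
def limits (c : ℕ → Q0 P C) : Set (Q0 P C) := {d | Tendsto c atTop (𝓝 d)}

/-- A point of the quotient space is Hausdorff if every net converging to it has a unique limit
(nets are replaced by proper filters). -/
def IsHausdorffPoint (c : Q0 P C) : Prop :=
  ∀ F : Filter (Q0 P C), F.NeBot → F ≤ 𝓝 c → ∀ d, F ≤ 𝓝 d → d = c

end WielerSystem

end

/-! By `rel0_iff`, `x ∼₀ y` means that `π₀` maps the neighbourhood filters of `x` and `y` to the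
same filter on `Y`: the two points lie over the same point and their unstable germs have the same
image. Since `π₀` is injective on local unstable sets, the quotient map resembles a local
homeomorphism between fibred spaces: it is open, and a sequence of classes converging to `[w]₀`
lifts, uniquely near `w`, to representatives converging to `w`.

All limits of a sequence of classes lie over the single point `lim π₀(x_n)` of `Y`. Fibres of the
quotient over `Y` are finite (`finite_cls_fiber`): shadowing, which comes from the second axiom,
shows that points with equal zeroth and close `K`-th coordinates are equivalent, and `Y` is totally
bounded. Hence `L` is finite.

The unit space is closed in `G₀(P)` and carries the topology of `X^u(P)` (`isClosedEmbedding_diag`),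
so the units in the support of `f` form a compact set `D`. Only finitely many `w ∈ D` have class in
`L`, and each yields a lift `σ_w(n) ∼₀ x_n` with `σ_w(n) → w`. For large `n` no other point
contributes to `τ_{x_n}(f)`: otherwise compactness gives a limit in `D` along a subsequence, and its
class is in `L` because subsequences have no new limits. So `τ_{x_n}(f) = ∑_w f(σ_w(n), σ_w(n))`
eventually, and continuity of `f` gives the limit (`tendsto_traceAt`). At a Hausdorff point every
sequence converging to it has `L` equal to that point alone. -/

namespace WielerSystem

variable {Y : Type u} [MetricSpace Y] [CompactSpace Y] {W : WielerSystem Y}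

/-! ### Shadowing and unstable equivalence in the solenoid -/

/-- Shadowing: a point `v` whose `K`-th coordinate is close to that of `w` has the same zeroth
coordinate as a point of a small local unstable set of `w`. -/
lemma exists_shadow {η : ℝ} (hη : 0 < η) : ∃ ε > 0, ∀ v w : W.X,
    dist (v.coord W.K) (w.coord W.K) < ε →
      ∃ z : W.X, z.coord 0 = v.coord 0 ∧ ∀ n, dist (w.coord n) (z.coord n) < η := by
  have huc : ∀ i : ℕ, ∃ ε > 0, ∀ a b : Y, dist a b < ε → dist (W.g^[i] a) (W.g^[i] b) < η :=
    fun i => by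
      have := CompactSpace.uniformContinuous_of_continuous (W.continuous_g.iterate i)
      obtain ⟨ε, h1, h2⟩ := Metric.uniformContinuous_iff.1 this η hη
      exact ⟨ε, h1, fun a b hab => h2 hab⟩
  choose e he0 he using huc
  obtain ⟨ε', hε'0, hε'⟩ : ∃ ε > 0, ∀ i ∈ Finset.range (2 * W.K + 1), ε ≤ e i := by
    refine ⟨(Finset.range (2 * W.K + 1)).inf' ⟨0, by simp⟩ e, ?_, fun i hi => Finset.inf'_le _ hi⟩
    exact (Finset.lt_inf'_iff _).2 fun i _ => he0 i
  set ε := min ε' W.β with hεdef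
  have hε0 : 0 < ε := lt_min hε'0 W.β_pos
  refine ⟨ε, hε0, fun v w hvw => ?_⟩
  -- The second axiom, centred at `w_{(j+2)K}`, pulls a point near `w_{(j+1)K}` back to one near
  -- `w_{(j+2)K}`. The value `a` in the other case only makes the choice total.
  have step : ∀ (j : ℕ) (a : Y), ∃ b : Y, dist a (w.coord ((j + 1) * W.K)) < ε →
      dist b (w.coord ((j + 2) * W.K)) < ε ∧ W.g^[2 * W.K] b = W.g^[W.K] a := by
    intro j a
    by_cases ha : dist a (w.coord ((j + 1) * W.K)) < ε
    · have h := W.axiom_two (w.coord ((j + 2) * W.K)) ε hε0 (min_le_right _ _)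
      rw [show (j + 2) * W.K = (j + 1) * W.K + W.K by ring, iterate_coord] at h
      obtain ⟨b, hb, hba⟩ := h (mem_image_of_mem _ (Metric.mem_ball.2 ha))
      refine ⟨b, fun _ => ⟨?_, hba⟩⟩
      rw [show (j + 2) * W.K = (j + 1) * W.K + W.K by ring]
      exact (Metric.mem_ball.1 hb).trans_le
        (mul_le_of_le_one_left hε0.le W.γ_lt_one.le)
    · exact ⟨a, fun h => absurd h ha⟩
  choose s hs using step
  let u : ℕ → Y := fun j => Nat.rec (v.coord W.K) s j
  have hu : ∀ j, dist (u j) (w.coord ((j + 1) * W.K)) < ε := by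
    intro j
    induction j with
    | zero => simpa [u] using hvw
    | succ j ih => exact (hs j (u j) ih).1
  have hug : ∀ j, W.g^[2 * W.K] (u (j + 1)) = W.g^[W.K] (u j) := fun j => (hs j (u j) (hu j)).2
  have hK := W.K_pos
  have hdiv : ∀ n, n ≤ (n / W.K + 1) * W.K ∧ (n / W.K + 1) * W.K ≤ n + W.K := by
    intro n
    have h1 := Nat.div_add_mod n W.K
    have h2 := Nat.mod_lt n hK
    have h3 := Nat.mul_comm W.K (n / W.K)
    rw [Nat.succ_mul]
    omega
  -- The `u j` are compatible only after applying `g^K`, hence the additional `K` in the exponent.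
  -- The exponent is at most `2K`, the range over which `ε'` was chosen.
  let z : ℕ → Y := fun n => W.g^[W.K + ((n / W.K + 1) * W.K - n)] (u (n / W.K + 1))
  have hz : ∀ i, W.g (z (i + 1)) = z i := by
    intro n
    have h1 := hdiv n
    have h2 := hdiv (n + 1)
    simp only [z]
    rw [← Function.iterate_succ_apply' W.g]
    rcases h1.1.eq_or_lt with h | h
    · exfalso
      have h3 := Nat.div_add_mod n W.K
      have h4 := Nat.mod_lt n hK
      have h5 := Nat.mul_comm W.K (n / W.K)
      rw [Nat.succ_mul] at h
      omega
    -- Only when `n + 1` is a multiple of `K` does the index of `u` jump; there the relation `hug`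
    -- is needed.
    · rcases (Nat.succ_le_of_lt h).eq_or_lt with h' | h'
      · have e1 : (n + 1) / W.K = n / W.K + 1 := by
          rw [← Nat.succ_eq_add_one n, h']
          exact Nat.mul_div_cancel _ hK
        have e2 : (n / W.K + 1 + 1) * W.K = (n + 1) + W.K := by
          rw [Nat.succ_mul, ← h']
        rw [e1, e2, ← h', show (W.K + (n + 1 + W.K - (n + 1))).succ = 1 + 2 * W.K by omega,
          Function.iterate_add_apply, hug, ← Function.iterate_add_apply,
          show 1 + W.K = W.K + (n.succ - n) by omega]
      · have e1 : (n + 1) / W.K = n / W.K := by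
          apply Nat.div_eq_of_lt_le
          · have := Nat.div_mul_le_self n W.K
            omega
          · exact h'
        rw [e1, show (W.K + ((n / W.K + 1) * W.K - (n + 1))).succ =
          W.K + ((n / W.K + 1) * W.K - n) by omega]
  refine ⟨⟨z, hz⟩, ?_, fun n => ?_⟩
  · change W.g^[W.K + ((0 / W.K + 1) * W.K - 0)] (u (0 / W.K + 1)) = _
    rw [Nat.zero_div, show W.K + ((0 + 1) * W.K - 0) = 2 * W.K by omega, hug]
    have := iterate_coord v W.K 0
    rwa [zero_add] at this
  · change dist (w.coord n) (W.g^[W.K + ((n / W.K + 1) * W.K - n)] (u (n / W.K + 1))) < η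
    have h1 := hdiv n
    have h2 : w.coord n = W.g^[W.K + ((n / W.K + 1) * W.K - n)]
        (w.coord ((n / W.K + 1 + 1) * W.K)) := by
      rw [Nat.succ_mul (n / W.K + 1), show (n / W.K + 1) * W.K + W.K =
        n + (W.K + ((n / W.K + 1) * W.K - n)) by omega, iterate_coord]
    rw [h2, dist_comm]
    refine he _ _ _ ((hu (n / W.K + 1)).trans_le ((min_le_left _ _).trans (hε' _ ?_)))
    rw [Finset.mem_range]
    omega

/-- On local unstable sets the iterates of `φ` are uniformly continuous. -/
lemma exists_dist_phi_iterate (W : WielerSystem Y) (k : ℕ) {η : ℝ} (hη : 0 < η) :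
    ∃ δ > 0, ∀ x z : W.X,
      (∀ n, dist (x.coord n) (z.coord n) ≤ W.epsX) → dist x z < δ →
        (∀ n, dist ((W.phi^[k] x).coord n) ((W.phi^[k] z).coord n) ≤ W.epsX) ∧
          dist (W.phi^[k] x) (W.phi^[k] z) < η := by
  obtain ⟨ρ, hρ, h⟩ := W.dist_lt_of_coord_zero hη
  obtain ⟨δ, hδ, hg⟩ := Metric.uniformContinuous_iff.1
    (CompactSpace.uniformContinuous_of_continuous (W.continuous_g.iterate k))
    (min ρ W.epsX) (lt_min hρ (epsX_pos (W := W)))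
  refine ⟨δ, hδ, fun x z hxz hd => ?_⟩
  have h1 : ∀ n, dist ((W.phi^[k] x).coord n) ((W.phi^[k] z).coord n) < min ρ W.epsX := by
    intro n
    rw [coord_phi_iterate, coord_phi_iterate]
    exact hg ((coord_le_dist _ _ (fun n => (hxz n).trans epsX_le) n).trans_lt hd)
  exact ⟨fun n => (h1 n).le.trans (min_le_right _ _),
    h _ _ (fun n => ((h1 n).le.trans (min_le_right _ _)).trans epsX_le)
      ((h1 0).trans_le (min_le_left _ _))⟩

lemma coord_phi_symm_iterate (x : W.X) (i n : ℕ) :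
    X.coord (W.phi.symm^[i] x) n = x.coord (n + i) := by
  induction i generalizing n with
  | zero => rfl
  | succ i ih =>
    rw [Function.iterate_succ_apply']
    exact (ih (n + 1)).trans (by rw [Nat.add_right_comm, Nat.add_assoc])

/-- `φ⁻ⁿ` moves the `n`-th coordinate to position zero, the first axiom makes it decay like `γⁿ`,
and a small zeroth coordinate distance controls `d_X`. -/
lemma unstableEquiv_of_dist_le {x z : W.X} (h : ∀ n, dist (x.coord n) (z.coord n) ≤ W.β) :
    UnstableEquiv x z := by
  rw [UnstableEquiv, Metric.tendsto_atTop]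
  intro ε hε
  obtain ⟨ρ, hρ, hd⟩ := W.dist_lt_of_coord_zero hε
  have h0 : Tendsto (fun n => W.γ ^ n * dist x z) atTop (𝓝 0) := by
    simpa using (tendsto_pow_atTop_nhds_zero_of_lt_one W.γ_pos.le W.γ_lt_one).mul_const (dist x z)
  obtain ⟨N, hN⟩ := eventually_atTop.1 (h0.eventually_lt_const hρ)
  refine ⟨N, fun n hn => ?_⟩
  rw [Real.dist_0_eq_abs, abs_of_nonneg dist_nonneg]
  refine hd _ _ (fun m => ?_) ?_
  · rw [coord_phi_symm_iterate, coord_phi_symm_iterate]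
    exact h _
  · rw [coord_phi_symm_iterate, coord_phi_symm_iterate, zero_add]
    exact (coord_le x z h n).trans_lt (hN n hn)

lemma UnstableEquiv.trans {x y z : W.X} (h : UnstableEquiv x y) (h' : UnstableEquiv y z) :
    UnstableEquiv x z :=
  squeeze_zero (fun _ => dist_nonneg) (fun _ => dist_triangle _ _ _)
    (by simpa using Tendsto.add h h')

lemma UnstableEquiv.symm {x y : W.X} (h : UnstableEquiv x y) : UnstableEquiv y x := by
  simpa only [UnstableEquiv, dist_comm] using h

/-! ### The topology of `X^u(P)` -/

variable {P : Set W.X}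

lemma exists_mem_unstableEquiv (x : W.XuP P) {z : W.X}
    (h : ∀ n, dist (x.1.coord n) (z.coord n) ≤ W.β) : ∃ p ∈ P, UnstableEquiv z p := by
  obtain ⟨p, hp, hxp⟩ := x.2
  exact ⟨p, hp, (unstableEquiv_of_dist_le h).symm.trans hxp⟩

/-- Near `w` the topology is pulled back from `Y`; this gives first countability, so that sequences
suffice later. -/
lemma nhds_eq (w : W.XuP P) :
    𝓝 w = 𝓟 (locU w W.epsX) ⊓ comap pi0 (𝓝 (pi0 w)) := by
  apply le_antisymm
  · refine le_inf (le_principal_iff.2 ?_) continuous_pi0.continuousAt.le_comap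
    exact (isOpen_locU w epsX_pos le_rfl).mem_nhds (self_mem_locU w (epsX_pos (W := W)))
  · intro S hS
    obtain ⟨U, hUS, hU, hwU⟩ := mem_nhds_iff.1 hS
    obtain ⟨η, hη, hηU⟩ := exists_locU_subset hU hwU
    obtain ⟨ρ, hρ, h⟩ := exists_dist_pi0 (self_mem_locU w (epsX_pos (W := W))) hη
    exact mem_inf_of_inter (mem_principal_self _)
      (preimage_mem_comap (Metric.ball_mem_nhds _ hρ))
      fun v hv => hUS (hηU (h v hv.1 hv.2))

instance : FirstCountableTopology (W.XuP P) :=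
  ⟨fun w => by rw [nhds_eq]; infer_instance⟩

lemma locU_mem_nhds (w : W.XuP P) {ε : ℝ} (hε : 0 < ε) : locU w ε ∈ 𝓝 w :=
  mem_of_superset ((isOpen_locU w (lt_min hε (epsX_pos (W := W))) (min_le_right _ _)).mem_nhds
    (self_mem_locU w (lt_min hε (epsX_pos (W := W))))) (locU_mono w (min_le_left _ _))

instance : T2Space (W.XuP P) := by
  refine t2_iff_nhds.2 fun {v w} hne => ?_
  refine Subtype.ext (dist_le_zero.1 (le_of_forall_pos_le_add fun ε hε => ?_))
  obtain ⟨u, hu1, hu2⟩ := inf_neBot_iff.1 hne (locU_mem_nhds v (half_pos hε)) (locU_mem_nhds w (half_pos hε))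
  have := dist_triangle_right v.1 w.1 u.1
  linarith [(mem_locU.1 hu1).2, (mem_locU.1 hu2).2]

/-- Finitely many local unstable sets cover `D`, and each meets a fibre of `π₀` at most once. -/
lemma finite_inter_fiber {D : Set (W.XuP P)} (hD : IsCompact D) (p : Y) :
    (D ∩ pi0 ⁻¹' {p}).Finite := by
  obtain ⟨t, -, ht⟩ := hD.elim_nhds_subcover (fun w => locU w W.epsX)
    fun w _ => locU_mem_nhds w (epsX_pos (W := W))
  refine (t.finite_toSet.biUnion (t := fun w => locU w W.epsX ∩ pi0 ⁻¹' {p})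
    fun w _ => ?_).subset ?_
  · refine Set.Subsingleton.finite fun a ha b hb => pi0_injOn w W.epsX ha.1 hb.1 ?_
    exact (show pi0 a = p from ha.2).trans (show pi0 b = p from hb.2).symm
  · rintro v ⟨hvD, hvp⟩
    obtain ⟨w, hw, hvw⟩ := mem_iUnion₂.1 (ht hvD)
    exact mem_iUnion₂.2 ⟨w, hw, hvw, hvp⟩

variable {C : W.Constants}

/-! ### Fibres of the quotient space over `Y` -/

/-- If `v` is near `x`, then `v_K` is near `y_K`, so shadowing gives a point of `X^u(y, ε_Y)` over
`v_0`. Thus the germ of the image at `x` lies in that at `y`, and the situation is symmetric. -/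
lemma exists_rel0_of_dist_lt (P : Set W.X) (C : W.Constants) : ∃ ε > 0, ∀ x y : W.XuP P,
    pi0 x = pi0 y → dist (x.1.coord W.K) (y.1.coord W.K) < ε → Rel0 C x y := by
  obtain ⟨ρ, hρ, hd⟩ := W.dist_lt_of_coord_zero C.εY_pos
  obtain ⟨ε, hε, hsh⟩ := exists_shadow (W := W) (lt_min hρ (epsX_pos (W := W)))
  have key : ∀ x y : W.XuP P, pi0 x = pi0 y →
      dist (x.1.coord W.K) (y.1.coord W.K) < ε / 2 → map pi0 (𝓝 x) ≤ map pi0 (𝓝 y) := by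
    intro x y h0 hxy
    rw [map_pi0_nhds (isOpen_locU y C.εY_pos εY_le) Subset.rfl (self_mem_locU y C.εY_pos)]
    refine tendsto_nhdsWithin_iff.2 ⟨h0 ▸ continuous_pi0.tendsto x, ?_⟩
    filter_upwards [locU_mem_nhds x (half_pos hε)] with v hv
    have hv := mem_locU.1 hv
    have h1 := coord_le_dist _ _ (fun n => (hv.1 n).trans epsX_le) W.K
    have h2 := dist_triangle_left (v.1.coord W.K) (y.1.coord W.K) (x.1.coord W.K)
    obtain ⟨z, hz0, hz⟩ := hsh v.1 y.1 (by linarith [hv.2])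
    have hzX : ∀ n, dist (y.1.coord n) (z.coord n) ≤ W.epsX := fun n =>
      (hz n).le.trans (min_le_right _ _)
    have hzβ : ∀ n, dist (y.1.coord n) (z.coord n) ≤ W.β := fun n => (hzX n).trans epsX_le
    exact ⟨⟨z, exists_mem_unstableEquiv y hzβ⟩, mem_locU.2 ⟨hzX, hd _ _ hzβ
      ((hz 0).trans_le (min_le_left _ _))⟩, hz0⟩
  exact ⟨ε / 2, half_pos hε, fun x y h0 h => rel0_iff.2
    (le_antisymm (key x y h0 h) (key y x h0.symm (by rwa [dist_comm])))⟩

lemma cls_eq_cls {x y : W.XuP P} : cls P C x = cls P C y ↔ Rel0 C x y :=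
  Quotient.eq (r := setoid0 P C)

variable (P C) in
-- Cover `Y` by finitely many balls of radius `ε / 2`; points of the fibre whose `K`-th coordinates
-- share a ball are equivalent.
lemma finite_cls_fiber (p : Y) : (cls P C '' (pi0 ⁻¹' {p})).Finite := by
  obtain ⟨ε, hε, h⟩ := exists_rel0_of_dist_lt P C
  obtain ⟨t, ht⟩ := (isCompact_univ (X := Y)).elim_nhds_subcover
    (fun y => Metric.ball y (ε / 2)) fun y _ => Metric.ball_mem_nhds y (half_pos hε)
  refine (t.finite_toSet.biUnion (t := fun y => cls P C '' (pi0 ⁻¹' {p} ∩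
    {x | dist (x.1.coord W.K) y < ε / 2})) fun y _ => ?_).subset ?_
  · refine Set.Subsingleton.finite ?_
    rintro _ ⟨a, ha, rfl⟩ _ ⟨b, hb, rfl⟩
    have h1 : pi0 a = p := ha.1
    have h2 : pi0 b = p := hb.1
    have h3 : dist (a.1.coord W.K) y < ε / 2 := ha.2
    have h4 : dist (b.1.coord W.K) y < ε / 2 := hb.2
    have h5 := dist_triangle_right (a.1.coord W.K) (b.1.coord W.K) y
    exact cls_eq_cls.2 (h a b (h1.trans h2.symm) (by linarith))
  · rintro _ ⟨x, hx, rfl⟩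
    obtain ⟨y, hy, hxy⟩ := mem_iUnion₂.1 (ht.2 (mem_univ (x.1.coord W.K)))
    exact mem_iUnion₂.2 ⟨y, hy, x, ⟨hx, hxy⟩, rfl⟩

/-! ### The quotient map -/

lemma continuous_cls : Continuous (cls P C) := continuous_quotient_mk'

/-- This is what makes the quotient map open: equality of image germs at one point persists at
nearby points. -/
lemma Rel0.exists_mem {x y : W.XuP P} (h : Rel0 C x y) {U : Set (W.XuP P)} (hU : U ∈ 𝓝 x) :
    ∀ᶠ y' in 𝓝 y, ∃ x' ∈ U, Rel0 C x' y' := by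
  obtain ⟨U', hU'U, hU', hxU'⟩ := mem_nhds_iff.1 hU
  have hox := hU'.inter (isOpen_locU x C.εY_pos εY_le)
  have hoy := isOpen_locU y C.εY_pos εY_le
  have hx : x ∈ U' ∩ locU x C.εY := ⟨hxU', self_mem_locU x C.εY_pos⟩
  have hy := self_mem_locU y C.εY_pos
  have e := rel0_iff.1 h
  rw [map_pi0_nhds hox inter_subset_right hx, map_pi0_nhds hoy Subset.rfl hy, ← h.1,
    nhdsWithin_eq_iff_eventuallyEq] at e
  have e' := h.1 ▸ eventually_eventually_nhds.2 e
  filter_upwards [hoy.mem_nhds hy, continuous_pi0.continuousAt.eventually e'] with y' hy' hO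
  obtain ⟨x', hx', hxy'⟩ : pi0 y' ∈ pi0 '' (U' ∩ locU x C.εY) :=
    (hO.self_of_nhds : _ = _).mpr (mem_image_of_mem _ hy')
  refine ⟨x', hU'U hx'.1, rel0_iff.2 ?_⟩
  rw [map_pi0_nhds hox inter_subset_right hx', map_pi0_nhds hoy Subset.rfl hy', hxy',
    nhdsWithin_eq_iff_eventuallyEq]
  exact hO

lemma isOpenMap_cls : IsOpenMap (cls P C) := by
  intro U hU
  refine isOpen_coinduced.2 (isOpen_iff_mem_nhds.2 ?_)
  rintro y ⟨x, hx, hxy⟩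
  filter_upwards [(cls_eq_cls.1 hxy).exists_mem (hU.mem_nhds hx)] with y' hy'
  obtain ⟨x', hx', hr⟩ := hy'
  exact ⟨x', hx', cls_eq_cls.2 hr⟩

lemma nhds_cls (x : W.XuP P) : 𝓝 (cls P C x) = map (cls P C) (𝓝 x) :=
  (isOpenMap_cls.map_nhds_eq continuous_cls.continuousAt).symm

/-- `π₀` descends to the quotient. As `Y` is Hausdorff, all limits of a sequence of classes lie over
one point. -/
lemma tendsto_pi0_of_tendsto_cls {x : ℕ → W.XuP P} {w : W.XuP P}
    (h : Tendsto (fun n => cls P C (x n)) atTop (𝓝 (cls P C w))) :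
    Tendsto (fun n => pi0 (x n)) atTop (𝓝 (pi0 w)) := by
  have hc : Continuous (Quotient.lift (s := setoid0 P C) pi0 fun _ _ h => h.1) :=
    continuous_pi0.quotient_lift _
  exact (hc.tendsto (cls P C w)).comp h

lemma exists_lift_of_tendsto_cls {x : ℕ → W.XuP P} {w : W.XuP P}
    (h : Tendsto (fun n => cls P C (x n)) atTop (𝓝 (cls P C w))) :
    ∃ σ : ℕ → W.XuP P, Tendsto σ atTop (𝓝 w) ∧ ∀ᶠ n in atTop, Rel0 C (σ n) (x n) := by
  have hev : ∀ U ∈ 𝓝 w, ∀ᶠ n in atTop, ∃ y ∈ U, Rel0 C y (x n) := by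
    intro U hU
    have : cls P C '' U ∈ 𝓝 (cls P C w) := by
      rw [nhds_cls]; exact image_mem_map hU
    filter_upwards [h this] with n hn
    obtain ⟨y, hy, hyx⟩ := hn
    exact ⟨y, hy, cls_eq_cls.1 hyx⟩
  -- One choice serves all neighbourhoods: `X^u(w, ε_Y)` has at most one point over `π₀(x_n)`, so
  -- the chosen point lies in every smaller neighbourhood that contains a representative.
  have hsel : ∀ n, ∃ y, (∃ y ∈ locU w C.εY, Rel0 C y (x n)) → y ∈ locU w C.εY ∧ Rel0 C y (x n) :=
    fun n => by
      by_cases hn : ∃ y ∈ locU w C.εY, Rel0 C y (x n)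
      · obtain ⟨y, hy⟩ := hn
        exact ⟨y, fun _ => hy⟩
      · exact ⟨w, fun h => absurd h hn⟩
  choose σ hσ using hsel
  refine ⟨σ, tendsto_iff_forall_eventually_mem.2 fun U hU => ?_, (hev _ (locU_mem_nhds w C.εY_pos)).mono fun n hn => (hσ n hn).2⟩
  filter_upwards [hev _ (inter_mem hU (locU_mem_nhds w C.εY_pos))] with n hn
  obtain ⟨y, hy, hyx⟩ := hn
  have hs := hσ n ⟨y, hy.2, hyx⟩
  have : σ n = y := pi0_injOn w C.εY hs.1 hy.2 (hs.2.1.trans hyx.1.symm)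
  exact this ▸ hy.1

lemma finite_limits (x : ℕ → W.XuP P) : (limits fun n => cls P C (x n)).Finite := by
  rcases (limits fun n => cls P C (x n)).eq_empty_or_nonempty with h | ⟨d, hd⟩
  · rw [h]; exact finite_empty
  · induction d using Quotient.inductionOn with | _ w =>
    refine (finite_cls_fiber P C (pi0 w)).subset fun d' hd' => ?_
    induction d' using Quotient.inductionOn with | _ w' =>
    exact ⟨w', tendsto_nhds_unique (tendsto_pi0_of_tendsto_cls hd')
      (tendsto_pi0_of_tendsto_cls hd), rfl⟩

/-! ### The unit space of `G₀(P)` -/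

/-- A chart containing a unit `(z, z)` is centred on the diagonal: `φ^k x` and `φ^k y` both shadow
`φ^k z` within `β / 2`, hence each other within `β`, and they share the zeroth coordinate, which
then determines the point. -/
lemma IsChart.eq_of_isBracket {x y z : W.XuP P} {k : ℕ} {δ : ℝ} (h : IsChart x y k δ)
    (hz : z ∈ locU y δ) (hb : IsBracket (W.phi^[k] z.1) (W.phi^[k] x.1) (W.phi^[k] z.1)) :
    x = y := by
  obtain ⟨-, -, hs, hu, -⟩ := h
  have h1 := (hu (mem_image_of_mem _ hz)).1.2
  have h2 : ∀ n, dist ((W.phi^[k] x.1).coord n) ((W.phi^[k] y.1).coord n) ≤ W.β := by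
    intro n
    have h3 := dist_triangle_right ((W.phi^[k] x.1).coord n) ((W.phi^[k] y.1).coord n)
      ((W.phi^[k] z.1).coord n)
    have h4 : W.epsX = W.β / 2 := rfl
    linarith [h1 n, hb.2 n]
  have h0 : (W.phi^[k] x.1).coord 0 = (W.phi^[k] y.1).coord 0 := hs.1.1 0 W.K_pos
  refine Subtype.ext (W.phi.injective.iterate k ?_)
  refine dist_le_zero.1 (le_of_forall_pos_le_add fun ε hε => ?_)
  obtain ⟨ρ, hρ, hd⟩ := W.dist_lt_of_coord_zero hε
  rw [zero_add]
  exact (hd _ _ h2 (by rwa [h0, dist_self])).le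

lemma toGs_diag_mem_chartSet {x y z : W.XuP P} {k : ℕ} {δ : ℝ} (h : IsChart x y k δ) :
    (diag C z).toGs ∈ chartSet x y k δ ↔ x = y ∧ z ∈ locU y δ := by
  constructor
  · rintro ⟨hz, hb⟩
    exact ⟨h.eq_of_isBracket hz hb, hz⟩
  · rintro ⟨rfl, hz⟩
    exact ⟨hz, fun _ _ => rfl, (h.2.2.2.1 (mem_image_of_mem _ hz)).1.2⟩

lemma isOpen_preimage_chartSet {x y : W.XuP P} {k : ℕ} {δ : ℝ} (hxy : StableEquiv x.1 y.1)
    (h : IsChart x y k δ) : IsOpen (G0.toGs (C := C) ⁻¹' chartSet x y k δ) :=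
  isOpen_induced (TopologicalSpace.isOpen_generateFrom_of_mem ⟨x, y, k, δ, hxy, h, rfl⟩)

lemma continuous_diag : Continuous (diag (P := P) C) := by
  refine continuous_induced_rng.2 (continuous_generateFrom_iff.2 ?_)
  rintro _ ⟨x, y, k, δ, -, h, rfl⟩
  by_cases hxy : x = y
  · convert isOpen_locU y h.1 h.2.1 using 1
    ext z
    exact (toGs_diag_mem_chartSet h).trans (and_iff_right hxy)
  · convert isOpen_empty using 1
    ext z
    exact (toGs_diag_mem_chartSet h).trans (by simp [hxy])

lemma injective_diag : Function.Injective (diag (P := P) C) := fun _ _ h =>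
  congrArg (fun p : G0 P C => p.1.1) h

lemma isChart_self (x : W.XuP P) {δ : ℝ} (h0 : 0 < δ) (h1 : δ ≤ W.epsX / 2) :
    IsChart x x 0 δ := by
  have hε := epsX_pos (W := W)
  refine ⟨h0, by linarith, ⟨⟨fun _ _ => rfl, fun n => ?_⟩, ?_⟩, ?_, fun z hz => ⟨z, hz.1⟩⟩
  · rw [dist_self]; exact hε.le
  · rw [dist_self]; exact half_pos hε
  · rintro _ ⟨z, hz, rfl⟩
    exact ⟨hz.1, hz.2.trans_le h1⟩

/-- Both entries shadow `x` and have the same zeroth coordinate, so they agree. This makes the unit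
space open. -/
lemma chartSet_self {x : W.XuP P} {δ : ℝ} {q : G0 P C} (hq : q.toGs ∈ chartSet x x 0 δ) :
    q = diag C q.1.2 := by
  obtain ⟨h1, h2⟩ := hq
  have h3 := (mem_locU.1 h1).1
  have : q.1.1 = q.1.2 := by
    -- The radius is immaterial: injectivity of `π₀` on `locU` holds for every radius.
    have h4 : q.1.1 ∈ locU x (dist x.1 q.1.1.1 + 1) :=
      mem_locU.2 ⟨h2.2, by linarith⟩
    have h5 : q.1.2 ∈ locU x (dist x.1 q.1.2.1 + 1) := mem_locU.2 ⟨h3, by linarith⟩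
    exact pi0_injOn x _ (locU_mono x (le_max_left _ _) h4) (locU_mono x (le_max_right _ _) h5)
      (h2.1 0 W.K_pos)
  exact Subtype.ext (Prod.ext this rfl)

lemma isOpenMap_diag : IsOpenMap (diag (P := P) C) := by
  intro U hU
  refine isOpen_iff_mem_nhds.2 ?_
  rintro _ ⟨x, hx, rfl⟩
  obtain ⟨η, hη, hηU⟩ := exists_locU_subset hU hx
  have h0 : 0 < min η (W.epsX / 2) := lt_min hη (half_pos epsX_pos)
  have hch := isChart_self x h0 (min_le_right _ _)
  have hst : StableEquiv x.1 x.1 := (rel0_iff.2 rfl : Rel0 C x x).stableEquiv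
  filter_upwards [(isOpen_preimage_chartSet hst hch).mem_nhds
    ((toGs_diag_mem_chartSet hch).2 ⟨rfl, self_mem_locU x h0⟩)] with q hq
  exact ⟨q.1.2, hηU (locU_mono x (min_le_left _ _) hq.1), (chartSet_self hq).symm⟩

/-- For `k ≥ K` the first `K` coordinates of `φ^k v` depend only on `v_0`. Hence `[φ^k z, φ^k x]` is
`φ^k v` for a `v` near `x` over `z_0`, which exists because the image germs of `x` and `y` agree. -/
lemma Rel0.exists_isChart {x y : W.XuP P} (h : Rel0 C x y) :
    ∃ k δ, IsChart x y k δ ∧ IsBracket (W.phi^[k] y.1) (W.phi^[k] x.1) (W.phi^[k] x.1) := by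
  have hε := epsX_pos (W := W)
  obtain ⟨k, hk, hkK⟩ := ((h.stableEquiv.eventually_lt_const (half_pos hε)).and
    (eventually_ge_atTop W.K)).exists
  have hcoord : ∀ (v z : W.X) (m : ℕ), v.coord 0 = z.coord 0 → m < W.K →
      (W.phi^[k] v).coord m = (W.phi^[k] z).coord m := by
    intro v z m hvz hm
    have e : ∀ z : W.X, (W.phi^[k] z).coord m = W.g^[k - m] (z.coord 0) := by
      intro z
      rw [coord_phi_iterate]
      conv_lhs => rw [← Nat.sub_add_cancel (hm.le.trans hkK), Function.iterate_add_apply]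
      congr 1
      have := iterate_coord z m 0
      rwa [zero_add] at this
    rw [e, e, hvz]
  obtain ⟨δ₁, hδ₁, hd⟩ := exists_dist_phi_iterate W k (half_pos hε)
  have hU : pi0 '' locU x δ₁ ∈ map pi0 (𝓝 y) := by
    rw [← rel0_iff.1 h]
    exact image_mem_map (locU_mem_nhds x hδ₁)
  obtain ⟨O, hOs, hO, hyO⟩ := mem_nhds_iff.1 (mem_map.1 hU)
  obtain ⟨δ₂, hδ₂, hsub⟩ := exists_locU_subset hO hyO
  have hb : IsBracket (W.phi^[k] y.1) (W.phi^[k] x.1) (W.phi^[k] x.1) :=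
    ⟨fun m hm => hcoord _ _ m h.1 hm, fun n => by rw [dist_self]; exact hε.le⟩
  refine ⟨k, min (min δ₁ δ₂) W.epsX, ⟨lt_min (lt_min hδ₁ hδ₂) hε, min_le_right _ _,
    ⟨hb, by rwa [dist_comm]⟩, ?_, fun z hz => ?_⟩, hb⟩
  · rintro _ ⟨z, hz, rfl⟩
    have := hd y.1 z hz.1.2 (hz.2.trans_le ((min_le_left _ _).trans (min_le_left _ _)))
    exact ⟨⟨fun _ _ => rfl, this.1⟩, this.2⟩
  · let z' : W.XuP P := ⟨z, exists_mem_unstableEquiv y fun n => (hz.1.2 n).trans epsX_le⟩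
    have hz' : z' ∈ locU y δ₂ :=
      locU_mono y ((min_le_left _ _).trans (min_le_right _ _)) hz
    obtain ⟨v, hv, hvz⟩ := hOs (hsub hz')
    have hv := mem_locU.1 hv
    exact ⟨W.phi^[k] v.1, fun m hm => hcoord _ _ m hvz hm, (hd x.1 v.1 hv.1 hv.2).1⟩

/-- The chart around a non-unit `(x, y)` has `x ≠ y`, so it contains no unit. -/
lemma isClosed_range_diag : IsClosed (range (diag (P := P) C)) := by
  refine isOpen_compl_iff.1 (isOpen_iff_mem_nhds.2 fun q hq => ?_)
  have hne : q.1.1 ≠ q.1.2 := fun h => hq ⟨q.1.2, Subtype.ext (Prod.ext h.symm rfl)⟩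
  obtain ⟨k, δ, hch, hb⟩ := Rel0.exists_isChart q.2
  filter_upwards [(isOpen_preimage_chartSet (C := C) q.2.stableEquiv hch).mem_nhds
    (show q.toGs ∈ chartSet q.1.1 q.1.2 k δ from ⟨self_mem_locU _ hch.1, hb⟩)] with q' hq'
  rintro ⟨z, rfl⟩
  exact hne ((toGs_diag_mem_chartSet hch).1 hq').1

lemma isClosedEmbedding_diag : IsClosedEmbedding (diag (P := P) C) :=
  ⟨(IsOpenEmbedding.of_continuous_injective_isOpenMap continuous_diag injective_diag
    isOpenMap_diag).isEmbedding, isClosed_range_diag⟩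

/-! ### The traces -/

/-- The points of the unit space at which `f` does not vanish lie in a compact set. -/
lemma isCompact_diag_preimage (f : C_c(G0 P C, ℂ)) : IsCompact (diag C ⁻¹' tsupport f) :=
  isClosedEmbedding_diag.isCompact_preimage f.hasCompactSupport

lemma mem_tsupport_of_ne_zero {f : C_c(G0 P C, ℂ)} {y : W.XuP P} (h : f (diag C y) ≠ 0) :
    y ∈ diag C ⁻¹' tsupport f := subset_tsupport f h

lemma finite_rel0_support (f : C_c(G0 P C, ℂ)) (x : W.XuP P) :
    {y : W.XuP P | Rel0 C y x ∧ f (diag C y) ≠ 0}.Finite :=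
  (finite_inter_fiber (isCompact_diag_preimage f) (pi0 x)).subset
    fun _ hy => ⟨mem_tsupport_of_ne_zero hy.2, hy.1.1⟩

lemma traceAt_eq_sum (f : C_c(G0 P C, ℂ)) (x : W.XuP P) (S : Finset (W.XuP P))
    (h1 : ∀ y ∈ S, Rel0 C y x) (h2 : ∀ y, Rel0 C y x → f (diag C y) ≠ 0 → y ∈ S) :
    traceAt f x = ∑ y ∈ S, f (diag C y) := by
  refine finsum_mem_eq_sum_of_inter_support_eq (s := {y | Rel0 C y x})
    (fun y => f (diag C y)) ?_
  ext y
  exact ⟨fun h => ⟨h2 y h.1 h.2, h.2⟩, fun h => ⟨h1 y h.1, h.2⟩⟩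

lemma finsum_trace_eq_sum (f : C_c(G0 P C, ℂ)) {A : Set (Q0 P C)} (hA : A.Finite)
    (S : Finset (W.XuP P)) (h1 : ∀ y ∈ S, cls P C y ∈ A)
    (h2 : ∀ y, cls P C y ∈ A → f (diag C y) ≠ 0 → y ∈ S) :
    ∑ᶠ d ∈ A, trace f d = ∑ y ∈ S, f (diag C y) := by
  classical
  rw [finsum_mem_eq_finite_toFinset_sum _ hA,
    ← Finset.sum_fiberwise_of_maps_to (g := cls P C) (fun y hy => hA.mem_toFinset.2 (h1 y hy))]
  refine Finset.sum_congr rfl fun d hd => ?_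
  induction d using Quotient.inductionOn with | _ x =>
  refine traceAt_eq_sum f x _ (fun y hy => cls_eq_cls.1 (Finset.mem_filter.1 hy).2)
    fun y hy hf => Finset.mem_filter.2 ⟨h2 y ?_ hf, cls_eq_cls.2 hy⟩
  have : cls P C y = cls P C x := cls_eq_cls.2 hy
  rw [this]
  exact hA.mem_toFinset.1 hd

lemma tendsto_traceAt (x : ℕ → W.XuP P) (hne : (limits fun n => cls P C (x n)).Nonempty)
    (hsub : ∀ k : ℕ → ℕ, StrictMono k →
      limits (fun j => cls P C (x (k j))) = limits fun n => cls P C (x n))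
    (f : C_c(G0 P C, ℂ)) :
    Tendsto (fun n => traceAt f (x n)) atTop
      (𝓝 (∑ᶠ w ∈ limits (fun n => cls P C (x n)), trace f w)) := by
  classical
  set A := limits fun n => cls P C (x n)
  set D := diag C ⁻¹' tsupport f
  have hD : IsCompact D := isCompact_diag_preimage f
  have hfin : (D ∩ cls P C ⁻¹' A).Finite := by
    obtain ⟨d, hd⟩ := hne
    induction d using Quotient.inductionOn with | _ w =>
    exact (finite_inter_fiber hD (pi0 w)).subset fun v hv => ⟨hv.1, tendsto_nhds_unique
      (tendsto_pi0_of_tendsto_cls hv.2) (tendsto_pi0_of_tendsto_cls hd)⟩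
  obtain ⟨U, hU, hdisj⟩ := hfin.t2_separation
  -- Disjointness keeps the lifts for different `w` distinct; the factor `locU` makes `π₀` injective
  -- on `V w`, so each `V w` holds at most one point equivalent to `x n`.
  let V : W.XuP P → Set (W.XuP P) := fun w => U w ∩ locU w C.εY
  have hV : ∀ w, V w ∈ 𝓝 w := fun w =>
    inter_mem ((hU w).2.mem_nhds (hU w).1) (locU_mem_nhds w C.εY_pos)
  have hlift : ∀ w, ∃ σ : ℕ → W.XuP P, w ∈ D ∩ cls P C ⁻¹' A →
      Tendsto σ atTop (𝓝 w) ∧ ∀ᶠ n in atTop, Rel0 C (σ n) (x n) := fun w => by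
    by_cases hw : w ∈ D ∩ cls P C ⁻¹' A
    · obtain ⟨σ, hσ⟩ := exists_lift_of_tendsto_cls hw.2
      exact ⟨σ, fun _ => hσ⟩
    · exact ⟨fun _ => w, fun h => absurd h hw⟩
  choose σ hσ using hlift
  -- The only use of the hypothesis on subsequences: contributing points outside all `V w` would
  -- accumulate at some `w ∈ D` whose class is a limit of a subsequence, hence in `A`.
  have hcov : ∀ᶠ n in atTop, ∀ y, Rel0 C y (x n) → f (diag C y) ≠ 0 →
      ∃ w ∈ hfin.toFinset, y ∈ V w := by
    by_contra hcon
    obtain ⟨k, hk, hbad⟩ := extraction_of_frequently_atTop (not_eventually.1 hcon)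
    push Not at hbad
    choose y hyx hyf hyV using hbad
    obtain ⟨w, hwD, m, hm, hw⟩ := hD.tendsto_subseq fun n => mem_tsupport_of_ne_zero (hyf n)
    have hwA : cls P C w ∈ A := by
      rw [← hsub (k ∘ m) (hk.comp hm)]
      refine ((continuous_cls.tendsto w).comp hw).congr fun j => ?_
      exact cls_eq_cls.2 (hyx (m j))
    obtain ⟨j, hj⟩ := (hw.eventually (hV w)).exists
    exact hyV (m j) w (hfin.mem_toFinset.2 ⟨hwD, hwA⟩) hj
  have hσV : ∀ᶠ n in atTop, ∀ w ∈ hfin.toFinset, σ w n ∈ V w ∧ Rel0 C (σ w n) (x n) := by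
    refine (Finset.eventually_all _).2 fun w hw => ?_
    have h := hσ w (hfin.mem_toFinset.1 hw)
    exact (h.1.eventually (hV w)).and h.2
  have hlim : Tendsto (fun n => ∑ w ∈ hfin.toFinset, f (diag C (σ w n))) atTop
      (𝓝 (∑ w ∈ hfin.toFinset, f (diag C w))) :=
    tendsto_finsetSum _ fun w hw => ((f.continuous.comp continuous_diag).tendsto w).comp
      (hσ w (hfin.mem_toFinset.1 hw)).1
  rw [finsum_trace_eq_sum f (finite_limits x) hfin.toFinset
    (fun y hy => (hfin.mem_toFinset.1 hy).2)
    fun y hy hf => hfin.mem_toFinset.2 ⟨mem_tsupport_of_ne_zero hf, hy⟩]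
  refine hlim.congr' ?_
  -- For such `n` the points contributing to the trace are among the distinct `σ w n`.
  filter_upwards [hcov, hσV] with n hn hs
  rw [traceAt_eq_sum f (x n) (hfin.toFinset.image fun w => σ w n), Finset.sum_image]
  · intro v hv w hw hvw
    by_contra hne
    refine disjoint_left.1 (hdisj (hfin.mem_toFinset.1 hv) (hfin.mem_toFinset.1 hw) hne)
      (hs v hv).1.1 ?_
    have hvw : σ v n = σ w n := hvw
    rw [hvw]
    exact (hs w hw).1.1
  · intro y hy
    obtain ⟨w, hw, rfl⟩ := Finset.mem_image.1 hy
    exact (hs w hw).2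
  · intro y hyx hyf
    obtain ⟨w, hw, hyw⟩ := hn y hyx hyf
    exact Finset.mem_image.2 ⟨w, hw, pi0_injOn w C.εY (hs w hw).1.2 hyw.2
      ((hs w hw).2.1.trans hyx.1.symm)⟩

/-- Neighbourhoods of `c` are images of neighbourhoods in a first countable space, so sequences
upstairs suffice; all their subsequences have `c` as unique limit. -/
lemma IsHausdorffPoint.continuousAt_trace {c : Q0 P C} (hc : IsHausdorffPoint c)
    (f : C_c(G0 P C, ℂ)) : ContinuousAt (trace f) c := by
  induction c using Quotient.inductionOn with | _ x =>
  change Tendsto (trace f) (𝓝 (cls P C x)) (𝓝 (trace f (cls P C x)))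
  rw [nhds_cls, tendsto_map'_iff]
  refine tendsto_of_seq_tendsto fun y hy => ?_
  have hcy : Tendsto (fun n => cls P C (y n)) atTop (𝓝 (cls P C x)) :=
    (continuous_cls.tendsto x).comp hy
  have hlim : ∀ k : ℕ → ℕ, StrictMono k →
      limits (fun j => cls P C (y (k j))) = {cls P C x} := by
    intro k hk
    have h := hcy.comp hk.tendsto_atTop
    exact Subset.antisymm (fun d hd => hc _ (map_neBot (f := atTop)) h d hd)
      (singleton_subset_iff.2 h)
  have h := hlim id strictMono_id
  simp only [id] at h
  have := tendsto_traceAt y ⟨_, hcy⟩ (fun k hk => (hlim k hk).trans h.symm) f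
  rwa [h, finsum_mem_singleton] at this

end WielerSystem

theorem mainTheorem11 {Y : Type u} [MetricSpace Y] [CompactSpace Y] [Infinite Y]
    (W : WielerSystem Y) (hmix : W.Mixing)
    (P : Set W.X) (hP : P.Finite) (hPinv : W.phi '' P = P) (C : W.Constants) :
    -- the sums defining the traces are finite
    (∀ (f : C_c(WielerSystem.G0 P C, ℂ)) (x : W.XuP P),
      {y : W.XuP P | WielerSystem.Rel0 C y x ∧ f (WielerSystem.diag C y) ≠ 0}.Finite) ∧
    -- the limit of the traces along a convergent sequence
    (∀ x : ℕ → W.XuP P,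
      (∃ d, Tendsto (fun n => WielerSystem.cls P C (x n)) atTop (𝓝 d)) →
      (∀ k : ℕ → ℕ, StrictMono k →
        WielerSystem.limits (fun j => WielerSystem.cls P C (x (k j))) =
          WielerSystem.limits (fun n => WielerSystem.cls P C (x n))) →
      (WielerSystem.limits (fun n => WielerSystem.cls P C (x n))).Finite ∧
      ∀ f : C_c(WielerSystem.G0 P C, ℂ),
        Tendsto (fun n => WielerSystem.traceAt f (x n)) atTop
          (𝓝 (∑ᶠ w ∈ WielerSystem.limits (fun n => WielerSystem.cls P C (x n)),
            WielerSystem.trace f w))) ∧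
    -- continuity on the set of Hausdorff points
    (∀ f : C_c(WielerSystem.G0 P C, ℂ),
      ContinuousOn (WielerSystem.trace f) {c | WielerSystem.IsHausdorffPoint c}) :=
  ⟨WielerSystem.finite_rel0_support,
    fun x hx hsub => ⟨WielerSystem.finite_limits x, WielerSystem.tendsto_traceAt x hx hsub⟩,
    fun f _ hc => (WielerSystem.IsHausdorffPoint.continuousAt_trace hc f).continuousWithinAt⟩
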